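/- **Lemma 3.1 (3D unisolvence).** Let $k\ge 4$ be an integer, let $h>0$, $\mathbf a\in\mathbb R^3$, and let $T=\prod_{i=1}^3[a_i,a_i+h]$ be a cube of size $h$. For $d\ge 1$ let $Q_k$ denote the span of the monomials $x_1^{k_1}\cdots x_d^{k_d}$ with $0\le k_i\le k$, as real polynomials in $d$ variables, and let $$V_T=\{v\in Q_k(T):\ \partial_{\mathbf n}v|_e\in Q_{k-1}(e)\ \text{for each of the six faces } e \text{ of } T\},$$ where $\partial_{\mathbf n}$ is the normal derivative on the face $e$ and $Q_{k-1}(e)$ is $Q_{k-1}$ in the two coordinates of $e$. Consider the following degrees of freedom (linear functionals of $v$), in which a normal derivative is the partial derivative in the corresponding coordinate direction: 1. $v,\partial_xv,\partial_yv,\partial_zv,\partial_{xy}v,\partial_{xz}v,\partial_{yz}v,\partial_{xyz}v$ at the eight vertices of $T$; 2. $v$ at the $k-3$ interior points of each of the 12 edges that divide the edge into $k-2$ equal parts; 3. $\partial_{\mathbf n_1}v,\partial_{\mathbf n_2}v,\partial_{\mathbf n_1\mathbf n_2}v$ at the $k-4$ interior points of each of the 12 edges that divide the edge into $k-3$ equal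 parts, where $\mathbf n_1,\mathbf n_2$ are the two coordinate directions orthogonal to the edge; 4. $v$ at the $(k-3)^2$ interior points $h\left(\frac i{k-2},\frac j{k-2}\right)$, $1\le i,j\le k-3$ (relative to the lowest corner of the face), of each of the 6 faces; 5. $\partial_{\mathbf n}v$ at the $(k-4)^2$ interior points $h\left(\frac i{k-3},\frac j{k-3}\right)$, $1\le i,j\le k-4$ (relative to the lowest corner of the face), of each of the 6 faces; 6. $v$ at the $(k-3)^3$ interior points $\mathbf a+\frac h{k-2}(i,j,l)$, $1\le i,j,l\le k-3$, of $T$. Then the number of these degrees of freedom is $k^3+3k^2-9k+7$, and they uniquely determine a function of $V_T$: for every assignment of real values to the degrees of freedom there is exactly one $v\in V_T$ whose degrees of freedom take these values. -/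

import Mathlib

namespace Bell3D

noncomputable section

/-- Points of three-dimensional space, by coordinates. -/
abbrev Point : Type := Fin 3 → ℝ

/-- The closed cube of size `h` whose lowest corner is `a`. -/
def cube (a : Point) (h : ℝ) : Set Point :=
  {x | ∀ i, x i ∈ Set.Icc (a i) (a i + h)}

/-- The two faces of the cube orthogonal to the coordinate direction `i`:
`c = 0` is the face `x i = a i`, and `c = 1` is the face `x i = a i + h`. -/
def face (a : Point) (h : ℝ) (i : Fin 3) (c : Fin 2) : Set Point :=
  {x | x ∈ cube a h ∧ x i = a i + h * ((c : ℕ) : ℝ)}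

/-- `Q_k` in `d` variables: the real polynomials of degree at most `k` in each variable. -/
abbrev Q (d k : ℕ) : Submodule ℝ (MvPolynomial (Fin d) ℝ) :=
  MvPolynomial.restrictDegree (Fin d) ℝ k

/-- The Bell space: the polynomials `v` in `Q_k` in three variables such that, on each of
the six faces of the cube, the normal derivative of `v` coincides with a polynomial in `Q_{k-1}`
in the two coordinates of that face (the coordinates `i.succAbove 0` and `i.succAbove 1`, other
than `i`). -/
def bellSpace (a : Point) (h : ℝ) (k : ℕ) : Submodule ℝ (MvPolynomial (Fin 3) ℝ) where
  carrier := {v | v ∈ Q 3 k ∧ ∀ (i : Fin 3) (c : Fin 2), ∃ q ∈ Q 2 (k - 1),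
    ∀ x ∈ face a h i c,
      MvPolynomial.eval x (MvPolynomial.pderiv i v)
        = MvPolynomial.eval (fun m => x (i.succAbove m)) q}
  zero_mem' := ⟨Submodule.zero_mem _, fun _ _ => ⟨0, Submodule.zero_mem _, by simp⟩⟩
  add_mem' := by
    rintro v w ⟨hv, hv'⟩ ⟨hw, hw'⟩
    refine ⟨Submodule.add_mem _ hv hw, fun i c => ?_⟩
    obtain ⟨p, hp, hp'⟩ := hv' i c
    obtain ⟨q, hq, hq'⟩ := hw' i c
    exact ⟨p + q, Submodule.add_mem _ hp hq, fun x hx => by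
      simp [hp' x hx, hq' x hx]⟩
  smul_mem' := by
    rintro r v ⟨hv, hv'⟩
    refine ⟨Submodule.smul_mem _ r hv, fun i c => ?_⟩
    obtain ⟨p, hp, hp'⟩ := hv' i c
    exact ⟨r • p, Submodule.smul_mem _ r hp, fun x hx => by
      simp [hp' x hx]⟩

/-- The labels of the degrees of freedom. A corner in `{0,1}^d` is `s : Fin d → Fin 2`; an edge is
given by its direction `i` and the corner `s` where it meets the plane of the other two
coordinates; a face is given by its normal direction `i` and its side `c`. -/
inductive Dof (k : ℕ) : Type
  /-- the derivative of order `α` (each `α i` is 0 or 1) at the vertex `s` -/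
  | vertex (s : Fin 3 → Fin 2) (α : Fin 3 → Fin 2)
  /-- the value at the `k - 3` mid-points of an edge -/
  | edgeValue (i : Fin 3) (s : Fin 2 → Fin 2) (j : Fin (k - 3))
  /-- the derivative in one of the two normal directions at `k - 4` mid-points of an edge -/
  | edgeNormal (i : Fin 3) (s : Fin 2 → Fin 2) (m : Fin 2) (j : Fin (k - 4))
  /-- the mixed derivative in the two normal directions at `k - 4` mid-points of an edge -/
  | edgeMixed (i : Fin 3) (s : Fin 2 → Fin 2) (j : Fin (k - 4))
  /-- the value at the `(k - 3)^2` mid-points of a face -/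
  | faceValue (i : Fin 3) (c : Fin 2) (j : Fin 2 → Fin (k - 3))
  /-- the normal derivative at `(k - 4)^2` mid-points of a face -/
  | faceNormal (i : Fin 3) (c : Fin 2) (j : Fin 2 → Fin (k - 4))
  /-- the value at the `(k - 3)^3` mid-points of the cube -/
  | interior (j : Fin 3 → Fin (k - 3))

/-- The point `a + h t`, where `t` is a point of the unit cube. -/
def cubePoint (a : Point) (h : ℝ) (t : Fin 3 → ℝ) : Point := fun i => a i + h * t i

/-- The `n` equally spaced mid-points `1/(n+1), …, n/(n+1)` of the unit interval. -/
def midPoint {n : ℕ} (j : Fin n) : ℝ := ((j : ℕ) + 1 : ℝ) / (n + 1 : ℝ)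

/-- The mixed partial derivative of order `α i` in the `i`-th variable, for `i = 0, 1, 2`. -/
def mixedDeriv (α : Fin 3 → Fin 2) (v : MvPolynomial (Fin 3) ℝ) : MvPolynomial (Fin 3) ℝ :=
  (MvPolynomial.pderiv 0)^[(α 0 : ℕ)]
    ((MvPolynomial.pderiv 1)^[(α 1 : ℕ)] ((MvPolynomial.pderiv 2)^[(α 2 : ℕ)] v))

/-- The value of a degree of freedom at a polynomial `v`. Here `i.insertNth t u` is the point with
`i`-th coordinate `t` and remaining two coordinates `u`. -/
def Dof.value (a : Point) (h : ℝ) {k : ℕ} (v : MvPolynomial (Fin 3) ℝ) : Dof k → ℝ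
  | .vertex s α =>
      MvPolynomial.eval (cubePoint a h fun i => ((s i : ℕ) : ℝ)) (mixedDeriv α v)
  | .edgeValue i s j =>
      MvPolynomial.eval
        (cubePoint a h (i.insertNth (midPoint j) fun m => ((s m : ℕ) : ℝ))) v
  | .edgeNormal i s m j =>
      MvPolynomial.eval
        (cubePoint a h (i.insertNth (midPoint j) fun m' => ((s m' : ℕ) : ℝ)))
        (MvPolynomial.pderiv (i.succAbove m) v)
  | .edgeMixed i s j =>
      MvPolynomial.eval
        (cubePoint a h (i.insertNth (midPoint j) fun m => ((s m : ℕ) : ℝ)))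
        (MvPolynomial.pderiv (i.succAbove 0) (MvPolynomial.pderiv (i.succAbove 1) v))
  | .faceValue i c j =>
      MvPolynomial.eval
        (cubePoint a h (i.insertNth ((c : ℕ) : ℝ) fun m => midPoint (j m))) v
  | .faceNormal i c j =>
      MvPolynomial.eval
        (cubePoint a h (i.insertNth ((c : ℕ) : ℝ) fun m => midPoint (j m)))
        (MvPolynomial.pderiv i v)
  | .interior j =>
      MvPolynomial.eval (cubePoint a h fun i => midPoint (j i)) v

end

end Bell3D

namespace Bell3D

noncomputable section

/-! On an interval, the values and first derivatives at the two ends together with the values at `n`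
mid-points determine a polynomial of degree at most `n + 3`. Tensor products of these functionals
therefore have a dual basis in `Q d (n + 3)`. Two such lattices are in play: `n = k - 4` for
`Q_{k-1}` and `n = k - 3` for `Q_k`. The degrees of freedom are exactly the `Q_{k-1}` functionals
containing some derivative and the `Q_k` functionals containing none (`node_bijective`).

Existence (`exists_mem_bellSpace_value_eq`): match the derivative data by some `u` in `Q_{k-1}`,
which lies in the Bell space. Then correct the values by a combination of derivative-free dual
functions of `Q_k`. The normal derivative of such a combination vanishes on every face, so the
correction stays in the Bell space and leaves the derivative data intact.

Uniqueness (`eq_zero_of_values_eq_zero`): if all data vanish, the normal derivative on each face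
lies in `Q_{k-1}` and is killed by every Hermite functional of that face, so it is zero. Hence all
`Q_k` functionals containing a derivative vanish. The remaining ones are degrees of freedom, so the
polynomial is zero. -/

/-! ### Tensor products of univariate polynomials and of jets. -/

/-- The product of univariate polynomials in separate variables. -/
def tensor {d : ℕ} (p : Fin d → Polynomial ℝ) : MvPolynomial (Fin d) ℝ :=
  ∏ i, Polynomial.aeval (MvPolynomial.X i) (p i)

/-- The derivative of order `α` at `x` of a univariate polynomial. -/
def jet (x : ℝ) (α : Fin 2) : Polynomial ℝ →ₗ[ℝ] ℝ :=
  Polynomial.leval x ∘ₗ (Polynomial.derivative ^ (α : ℕ))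

lemma jet_zero (x : ℝ) (p : Polynomial ℝ) : jet x 0 p = p.eval x := by
  simp [jet]

lemma jet_one (x : ℝ) (p : Polynomial ℝ) : jet x 1 p = p.derivative.eval x := by
  simp [jet]

/-- The tensor product of the functionals `jet (x i) (α i)`. -/
def tensorJet {d : ℕ} (x : Fin d → ℝ) (α : Fin d → Fin 2) : MvPolynomial (Fin d) ℝ →ₗ[ℝ] ℝ :=
  (MvPolynomial.basisMonomials (Fin d) ℝ).constr ℝ
    fun m => ∏ i, jet (x i) (α i) (Polynomial.X ^ m i)

lemma tensor_X_pow {d : ℕ} (m : Fin d →₀ ℕ) :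
    tensor (fun i => Polynomial.X ^ m i) = MvPolynomial.monomial m (1 : ℝ) := by
  rw [MvPolynomial.monomial_eq, Finsupp.prod_fintype _ _ (by simp)]
  simp [tensor]

lemma tensorJet_monomial {d : ℕ} (x : Fin d → ℝ) (α : Fin d → Fin 2) (m : Fin d →₀ ℕ) :
    tensorJet x α (MvPolynomial.monomial m 1) =
      ∏ i, jet (x i) (α i) (Polynomial.X ^ m i) := by
  rw [tensorJet, ← congrFun (MvPolynomial.coe_basisMonomials (Fin d) ℝ) m,
    Module.Basis.constr_basis]

lemma tensor_sum_smul {d : ℕ} {κ : Type*} [Fintype κ] (c : Fin d → κ → ℝ)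
    (p : Fin d → κ → Polynomial ℝ) :
    tensor (fun i => ∑ j, c i j • p i j) =
      ∑ m : Fin d → κ, (∏ i, c i (m i)) • tensor fun i => p i (m i) := by
  classical
  simp only [tensor, map_sum, map_smul]
  rw [Finset.prod_univ_sum, Fintype.piFinset_univ]
  exact Finset.sum_congr rfl fun m _ => Finset.prod_smul _ _ _

lemma eq_sum_fin_coeff {n : ℕ} {p : Polynomial ℝ} (hp : p.natDegree ≤ n) :
    p = ∑ j : Fin (n + 1), p.coeff j • Polynomial.X ^ (j : ℕ) := by
  conv_lhs => rw [p.as_sum_range' (n + 1) (Nat.lt_succ_of_le hp)]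
  rw [Finset.sum_range]
  exact Finset.sum_congr rfl fun j _ => by
    rw [← Polynomial.C_mul_X_pow_eq_monomial, Polynomial.smul_eq_C_mul]

lemma tensor_eq_sum_monomial {d n : ℕ} {p : Fin d → Polynomial ℝ} (hp : ∀ i, (p i).natDegree ≤ n) :
    tensor p = ∑ m : Fin d → Fin (n + 1), (∏ i, (p i).coeff (m i)) •
      MvPolynomial.monomial (Finsupp.equivFunOnFinite.symm fun i => (m i : ℕ)) (1 : ℝ) := by
  conv_lhs => rw [show p = _ from funext fun i => eq_sum_fin_coeff (hp i)]
  rw [tensor_sum_smul (fun i (j : Fin (n + 1)) => (p i).coeff j)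
    (fun _ (j : Fin (n + 1)) => Polynomial.X ^ (j : ℕ))]
  refine Finset.sum_congr rfl fun m _ => ?_
  rw [← tensor_X_pow]
  simp

lemma tensor_mem_Q {d n : ℕ} {p : Fin d → Polynomial ℝ} (hp : ∀ i, (p i).natDegree ≤ n) :
    tensor p ∈ Q d n := by
  rw [tensor_eq_sum_monomial hp]
  refine Submodule.sum_mem _ fun m _ => Submodule.smul_mem _ _ ?_
  rw [MvPolynomial.mem_restrictDegree]
  intro s hs i
  rw [Finset.mem_singleton.1 (MvPolynomial.support_monomial_subset hs)]
  simpa using Nat.lt_succ_iff.1 (m i).2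

/-- Both sides are multilinear in `p`, so the defining values of `tensorJet` on monomials suffice.
-/
lemma tensorJet_tensor {d : ℕ} (x : Fin d → ℝ) (α : Fin d → Fin 2) (p : Fin d → Polynomial ℝ) :
    tensorJet x α (tensor p) = ∏ i, jet (x i) (α i) (p i) := by
  classical
  obtain ⟨n, hn⟩ : ∃ n, ∀ i, (p i).natDegree ≤ n :=
    ⟨Finset.univ.sup fun i => (p i).natDegree, fun i =>
      Finset.le_sup (f := fun i => (p i).natDegree) (Finset.mem_univ i)⟩
  rw [tensor_eq_sum_monomial hn, map_sum]
  conv_rhs =>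
    rw [show p = _ from funext fun i => eq_sum_fin_coeff (hn i)]
    simp only [map_sum, map_smul]
    rw [Finset.prod_univ_sum, Fintype.piFinset_univ]
  refine Finset.sum_congr rfl fun m _ => ?_
  rw [map_smul, tensorJet_monomial]
  simp [Finset.prod_mul_distrib]

/-- Monomials are themselves tensors. Identities between evaluation, differentiation and restriction
thus reduce to one variable at a time. -/
lemma linearMap_ext_tensor {d : ℕ} {M : Type*} [AddCommMonoid M] [Module ℝ M]
    {f g : MvPolynomial (Fin d) ℝ →ₗ[ℝ] M} (hfg : ∀ p, f (tensor p) = g (tensor p)) : f = g := by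
  refine (MvPolynomial.basisMonomials (Fin d) ℝ).ext fun m => ?_
  rw [MvPolynomial.coe_basisMonomials]
  simp only [← tensor_X_pow, hfg]

lemma eval_tensor {d : ℕ} (x : Fin d → ℝ) (p : Fin d → Polynomial ℝ) :
    MvPolynomial.eval x (tensor p) = ∏ i, (p i).eval (x i) := by
  rw [tensor, map_prod]
  refine Finset.prod_congr rfl fun i _ => ?_
  have := Polynomial.aeval_algHom_apply (MvPolynomial.aeval x) (MvPolynomial.X i) (p i)
  simp only [MvPolynomial.aeval_X] at this
  rw [Polynomial.coe_aeval_eq_eval] at this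
  simpa [MvPolynomial.coe_aeval_eq_eval] using this.symm

lemma pderiv_tensor {d : ℕ} (i : Fin d) (p : Fin d → Polynomial ℝ) :
    MvPolynomial.pderiv i (tensor p) =
      tensor (Function.update p i (Polynomial.derivative (p i))) := by
  classical
  have key : ∀ j, MvPolynomial.pderiv i (Polynomial.aeval (MvPolynomial.X j) (p j)) =
      if j = i then Polynomial.aeval (MvPolynomial.X i : MvPolynomial (Fin d) ℝ)
        (Polynomial.derivative (p i)) else 0 := by
    intro j
    rw [Derivation.map_aeval, MvPolynomial.pderiv_X]
    rcases eq_or_ne j i with rfl | hj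
    · simp
    · simp [hj]
  -- The other factors do not involve the variable `i`, so the Leibniz rule leaves a single term.
  have hrest : MvPolynomial.pderiv i (∏ j ∈ Finset.univ.erase i,
      Polynomial.aeval (MvPolynomial.X j : MvPolynomial (Fin d) ℝ) (p j)) = 0 :=
    Finset.prod_induction _ (fun q => MvPolynomial.pderiv i q = 0)
      (fun q r hq hr => by rw [Derivation.leibniz, hq, hr, smul_zero, smul_zero, add_zero])
      (Derivation.map_one_eq_zero _)
      fun j hj => by rw [key, if_neg (Finset.ne_of_mem_erase hj)]
  rw [tensor, ← Finset.mul_prod_erase _ _ (Finset.mem_univ i), Derivation.leibniz, hrest,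
    key, if_pos rfl, tensor, ← Finset.mul_prod_erase _ _ (Finset.mem_univ i),
    Function.update_self, smul_zero, zero_add, smul_eq_mul, mul_comm]
  congr 1
  exact Finset.prod_congr rfl fun j hj => by
    rw [Function.update_of_ne (Finset.ne_of_mem_erase hj)]

/-! ### Restriction to coordinate hyperplanes; evaluation and derivatives as tensor jets. -/

/-- The restriction of a polynomial to the hyperplane `x i = c`. -/
def restrictPlane {d : ℕ} (i : Fin (d + 1)) (c : ℝ) :
    MvPolynomial (Fin (d + 1)) ℝ →ₐ[ℝ] MvPolynomial (Fin d) ℝ :=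
  MvPolynomial.aeval (i.insertNth (MvPolynomial.C c) MvPolynomial.X)

lemma restrictPlane_tensor {d : ℕ} (i : Fin (d + 1)) (c : ℝ) (p : Fin (d + 1) → Polynomial ℝ) :
    restrictPlane i c (tensor p) = (p i).eval c • tensor fun m => p (i.succAbove m) := by
  rw [tensor, map_prod, Fin.prod_univ_succAbove _ i]
  simp only [← Polynomial.aeval_algHom_apply]
  simp only [restrictPlane, MvPolynomial.aeval_X, Fin.insertNth_apply_same,
    Fin.insertNth_apply_succAbove]
  rw [← tensor, show (MvPolynomial.C c : MvPolynomial (Fin d) ℝ) = algebraMap _ _ c from rfl,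
    Polynomial.aeval_algebraMap_apply, Algebra.smul_def, Polynomial.coe_aeval_eq_eval]

lemma eval_restrictPlane {d : ℕ} (i : Fin (d + 1)) (c : ℝ) (y : Fin d → ℝ)
    (v : MvPolynomial (Fin (d + 1)) ℝ) :
    MvPolynomial.eval y (restrictPlane i c v) = MvPolynomial.eval (i.insertNth c y) v := by
  have : (MvPolynomial.aeval y).toLinearMap ∘ₗ (restrictPlane i c).toLinearMap =
      (MvPolynomial.aeval (i.insertNth c y : Fin (d + 1) → ℝ)).toLinearMap := by
    refine linearMap_ext_tensor fun p => ?_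
    simp only [LinearMap.comp_apply, AlgHom.toLinearMap_apply, restrictPlane_tensor,
      map_smul]
    simp [Fin.prod_univ_succAbove _ i, eval_tensor]
  simpa [MvPolynomial.coe_aeval_eq_eval] using LinearMap.congr_fun this v

lemma tensorJet_restrictPlane {d : ℕ} (i : Fin (d + 1)) (c : ℝ) (y : Fin d → ℝ) (α : Fin d → Fin 2)
    (v : MvPolynomial (Fin (d + 1)) ℝ) :
    tensorJet y α (restrictPlane i c (MvPolynomial.pderiv i v)) =
      tensorJet (i.insertNth c y) (i.insertNth 1 α) v := by
  have : tensorJet y α ∘ₗ (restrictPlane i c).toLinearMap ∘ₗ (MvPolynomial.pderiv i).toLinearMap =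
      tensorJet (i.insertNth c y) (i.insertNth 1 α) := by
    refine linearMap_ext_tensor fun p => ?_
    simp only [LinearMap.comp_apply, AlgHom.toLinearMap_apply, Derivation.coeFn_coe, pderiv_tensor, restrictPlane_tensor, map_smul, tensorJet_tensor]
    simp [Fin.prod_univ_succAbove _ i, jet_one]
  exact LinearMap.congr_fun this v

lemma eval_eq_tensorJet {d : ℕ} (x : Fin d → ℝ) (v : MvPolynomial (Fin d) ℝ) :
    MvPolynomial.eval x v = tensorJet x 0 v := by
  have : (MvPolynomial.aeval x).toLinearMap = tensorJet x 0 :=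
    linearMap_ext_tensor fun p => by
      simp [eval_tensor, tensorJet_tensor, jet_zero]
  simpa [MvPolynomial.coe_aeval_eq_eval] using LinearMap.congr_fun this v

/-- Orders take only the values 0 and 1, so `α i = 0` leaves room for one more derivative. -/
lemma tensorJet_pderiv {d : ℕ} (x : Fin d → ℝ) (α : Fin d → Fin 2) (i : Fin d) (hα : α i = 0)
    (v : MvPolynomial (Fin d) ℝ) :
    tensorJet x α (MvPolynomial.pderiv i v) = tensorJet x (Function.update α i 1) v := by
  classical
  have : tensorJet x α ∘ₗ (MvPolynomial.pderiv i).toLinearMap =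
      tensorJet x (Function.update α i 1) := by
    refine linearMap_ext_tensor fun p => ?_
    simp only [LinearMap.comp_apply, Derivation.coeFn_coe, pderiv_tensor, tensorJet_tensor]
    refine Finset.prod_congr rfl fun j _ => ?_
    rcases eq_or_ne j i with rfl | hj
    · simp [hα, jet_one, jet_zero]
    · simp [hj]
  exact LinearMap.congr_fun this v

/-! ### Univariate Hermite interpolation. -/

/-- Labels of the Hermite functionals on an interval: the jets `(c, α)` of order `α` at the end
points, and the values at `n` mid-points. -/
abbrev Node (n : ℕ) : Type := (Fin 2 × Fin 2) ⊕ Fin n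

/-- The position of a node in the unit interval. -/
def Node.pos {n : ℕ} : Node n → ℝ
  | .inl e => ((e.1 : ℕ) : ℝ)
  | .inr j => midPoint j

/-- The order of the derivative taken at a node. -/
def Node.order {n : ℕ} : Node n → Fin 2
  | .inl e => e.2
  | .inr _ => 0

/-- The Hermite functional of a node, on the interval `[a, a + h]`. -/
def Node.jet (a h : ℝ) {n : ℕ} (s : Node n) : Polynomial ℝ →ₗ[ℝ] ℝ :=
  Bell3D.jet (a + h * s.pos) s.order

lemma midPoint_pos {n : ℕ} (j : Fin n) : 0 < midPoint j := by
  unfold midPoint; positivity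

lemma midPoint_lt_one {n : ℕ} (j : Fin n) : midPoint j < 1 := by
  unfold midPoint
  rw [div_lt_one (by positivity)]
  exact_mod_cast Nat.succ_lt_succ j.2

lemma midPoint_injective {n : ℕ} : Function.Injective (midPoint : Fin n → ℝ) := by
  intro i j hij
  unfold midPoint at hij
  rw [div_left_inj' (by positivity)] at hij
  exact Fin.ext (by exact_mod_cast add_right_cancel hij)

lemma sq_dvd_of_jets_eq_zero {p : Polynomial ℝ} {x : ℝ} (h0 : jet x 0 p = 0) (h1 : jet x 1 p = 0) :
    (Polynomial.X - Polynomial.C x) ^ 2 ∣ p := by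
  rw [jet_zero] at h0
  rw [jet_one] at h1
  rcases eq_or_ne p 0 with rfl | hp
  · exact dvd_zero _
  · rw [← Polynomial.le_rootMultiplicity_iff hp]
    exact (Polynomial.one_lt_rootMultiplicity_iff_isRoot hp).2 ⟨h0, h1⟩

/-- Each end point contributes a double root and each mid-point a simple one. These factors are
pairwise coprime, so a product of degree `n + 4` divides `p`. -/
lemma eq_zero_of_nodeJets_eq_zero {a h : ℝ} (hh : 0 < h) {n : ℕ} {p : Polynomial ℝ}
    (hp : p.natDegree < n + 4) (hz : ∀ s : Node n, s.jet a h p = 0) : p = 0 := by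
  have hcop {x y : ℝ} (hxy : x ≠ y) :
      IsCoprime (Polynomial.X - Polynomial.C x) (Polynomial.X - Polynomial.C y) :=
    Polynomial.isCoprime_X_sub_C_of_isUnit_sub (sub_ne_zero.2 hxy).isUnit
  have ha : (Polynomial.X - Polynomial.C a) ^ 2 ∣ p := by
    apply sq_dvd_of_jets_eq_zero
    · simpa [Node.jet, Node.pos, Node.order] using hz (.inl (0, 0))
    · simpa [Node.jet, Node.pos, Node.order] using hz (.inl (0, 1))
  have hb : (Polynomial.X - Polynomial.C (a + h)) ^ 2 ∣ p := by
    apply sq_dvd_of_jets_eq_zero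
    · simpa [Node.jet, Node.pos, Node.order] using hz (.inl (1, 0))
    · simpa [Node.jet, Node.pos, Node.order] using hz (.inl (1, 1))
  have hm : ∏ j : Fin n, (Polynomial.X - Polynomial.C (a + h * midPoint j)) ∣ p := by
    refine Finset.prod_dvd_of_coprime (fun i _ j _ hij => hcop fun hij' => hij ?_) fun j _ => ?_
    · exact midPoint_injective (mul_left_cancel₀ hh.ne' (add_left_cancel hij'))
    · have := hz (.inr j)
      rw [Node.jet, Node.order, jet_zero] at this
      exact Polynomial.dvd_iff_isRoot.2 this
  have hab : (Polynomial.X - Polynomial.C a) ^ 2 * (Polynomial.X - Polynomial.C (a + h)) ^ 2 ∣ p :=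
    (hcop (by linarith)).pow.mul_dvd ha hb
  have hall := IsCoprime.mul_dvd (IsCoprime.mul_left
      (IsCoprime.prod_right fun j _ => (hcop ?_).pow_left)
      (IsCoprime.prod_right fun j _ => (hcop ?_).pow_left)) hab hm
  · by_contra hne
    have := Polynomial.natDegree_le_of_dvd hall hne
    have hmon : (∏ j : Fin n, (Polynomial.X - Polynomial.C (a + h * midPoint j))).Monic :=
      Polynomial.monic_prod_of_monic _ _ fun j _ => Polynomial.monic_X_sub_C _
    rw [(((Polynomial.monic_X_sub_C a).pow 2).mul
      ((Polynomial.monic_X_sub_C (a + h)).pow 2)).natDegree_mul hmon,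
      ((Polynomial.monic_X_sub_C a).pow 2).natDegree_mul
        ((Polynomial.monic_X_sub_C (a + h)).pow 2),
      Polynomial.natDegree_prod_of_monic _ _ fun j _ => Polynomial.monic_X_sub_C _] at this
    simp only [Polynomial.natDegree_pow, Polynomial.natDegree_X_sub_C, Finset.sum_const,
      Finset.card_univ, Fintype.card_fin, smul_eq_mul] at this
    omega
  · have := mul_pos hh (midPoint_pos j)
    exact (by linarith : a < a + h * midPoint j).ne
  · have := mul_lt_mul_of_pos_left (midPoint_lt_one j) hh
    exact (by linarith : a + h * midPoint j < a + h).ne'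

/-- The Hermite functionals are jointly injective on a space of dimension `n + 4`, which is also
their number, so they are jointly surjective. -/
lemma exists_dual_basis (a : ℝ) {h : ℝ} (hh : 0 < h) (n : ℕ) :
    ∃ b : Node n → Polynomial ℝ, (∀ s, (b s).natDegree ≤ n + 3) ∧
      ∀ s t : Node n, s.jet a h (b t) = if s = t then 1 else 0 := by
  let f : Polynomial.degreeLT ℝ (n + 4) →ₗ[ℝ] (Node n → ℝ) :=
    (LinearMap.pi fun s : Node n => s.jet a h) ∘ₗ Submodule.subtype _
  have hdeg (p : Polynomial.degreeLT ℝ (n + 4)) : (p : Polynomial ℝ).natDegree < n + 4 := by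
    rcases eq_or_ne (p : Polynomial ℝ) 0 with h0 | h0
    · simp [h0]
    · exact (Polynomial.natDegree_lt_iff_degree_lt h0).2 (Polynomial.mem_degreeLT.1 p.2)
  have hinj : Function.Injective f := by
    rw [← LinearMap.ker_eq_bot, LinearMap.ker_eq_bot']
    intro p hp
    exact Subtype.ext (eq_zero_of_nodeJets_eq_zero hh (hdeg p) fun s => congrFun hp s)
  have : FiniteDimensional ℝ (Polynomial.degreeLT ℝ (n + 4)) :=
    (Polynomial.degreeLTEquiv ℝ (n + 4)).symm.finiteDimensional
  have hsurj : Function.Surjective f := by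
    refine (LinearMap.injective_iff_surjective_of_finrank_eq_finrank ?_).1 hinj
    rw [(Polynomial.degreeLTEquiv ℝ (n + 4)).finrank_eq]
    simp
    omega
  choose g hg using fun t : Node n => hsurj (Pi.single t 1)
  refine ⟨fun t => g t, fun t => Nat.le_of_lt_succ (hdeg _), fun s t => ?_⟩
  simpa [f, Pi.single_apply] using congrFun (hg t) s

/-- The basis of the polynomials of degree at most `n + 3` dual to the Hermite functionals on
`[a, a + h]`. -/
def dual (a : ℝ) {h : ℝ} (hh : 0 < h) {n : ℕ} : Node n → Polynomial ℝ :=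
  (exists_dual_basis a hh n).choose

lemma natDegree_dual_le (a : ℝ) {h : ℝ} (hh : 0 < h) {n : ℕ} (s : Node n) :
    (dual a hh s).natDegree ≤ n + 3 :=
  (exists_dual_basis a hh n).choose_spec.1 s

lemma nodeJet_dual (a : ℝ) {h : ℝ} (hh : 0 < h) {n : ℕ} (s t : Node n) :
    s.jet a h (dual a hh t) = if s = t then 1 else 0 :=
  (exists_dual_basis a hh n).choose_spec.2 s t

lemma eq_sum_dual (a : ℝ) {h : ℝ} (hh : 0 < h) {n : ℕ} {p : Polynomial ℝ}
    (hp : p.natDegree ≤ n + 3) : p = ∑ s : Node n, s.jet a h p • dual a hh s := by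
  rw [← sub_eq_zero]
  refine eq_zero_of_nodeJets_eq_zero (a := a) hh (n := n) ?_ fun s => ?_
  · refine Nat.lt_succ_of_le ((Polynomial.natDegree_sub_le _ _).trans (max_le hp ?_))
    exact Polynomial.natDegree_sum_le_of_forall_le _ _ fun s _ =>
      (Polynomial.natDegree_smul_le _ _).trans (natDegree_dual_le a hh s)
  · simp [nodeJet_dual, -Fintype.sum_sum_type]

/-! ### Tensor-product Hermite interpolation on a cube. -/

/-- The tensor product of the Hermite functionals of `d` nodes, on the cube of size `h` whose lowest
corner is `a`. -/
def nodesJet {d n : ℕ} (a : Fin d → ℝ) (h : ℝ) (s : Fin d → Node n) :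
    MvPolynomial (Fin d) ℝ →ₗ[ℝ] ℝ :=
  tensorJet (fun i => a i + h * (s i).pos) fun i => (s i).order

lemma nodesJet_tensor {d n : ℕ} (a : Fin d → ℝ) (h : ℝ) (s : Fin d → Node n)
    (p : Fin d → Polynomial ℝ) : nodesJet a h s (tensor p) = ∏ i, (s i).jet (a i) h (p i) :=
  tensorJet_tensor _ _ _

/-- The tensor product basis dual to the functionals `nodesJet`. -/
def tensorDual {d n : ℕ} (a : Fin d → ℝ) {h : ℝ} (hh : 0 < h) (s : Fin d → Node n) :
    MvPolynomial (Fin d) ℝ :=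
  tensor fun i => dual (a i) hh (s i)

lemma nodesJet_tensorDual {d n : ℕ} (a : Fin d → ℝ) {h : ℝ} (hh : 0 < h) (s t : Fin d → Node n) :
    nodesJet a h s (tensorDual a hh t) = if s = t then 1 else 0 := by
  rw [tensorDual, nodesJet_tensor]
  simp only [nodeJet_dual]
  split_ifs with hst
  · simp [hst]
  · obtain ⟨i, hi⟩ := Function.ne_iff.1 hst
    exact Finset.prod_eq_zero (Finset.mem_univ i) (if_neg hi)

lemma nodesJet_sum_tensorDual {d n : ℕ} (a : Fin d → ℝ) {h : ℝ} (hh : 0 < h)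
    (G : (Fin d → Node n) → ℝ) (s : Fin d → Node n) :
    nodesJet a h s (∑ t, G t • tensorDual a hh t) = G s := by
  simp [nodesJet_tensorDual]

lemma tensorDual_mem_Q {d n : ℕ} (a : Fin d → ℝ) {h : ℝ} (hh : 0 < h) (s : Fin d → Node n) :
    tensorDual a hh s ∈ Q d (n + 3) :=
  tensor_mem_Q fun i => natDegree_dual_le (a i) hh (s i)

/-- Expand every univariate factor of a monomial in the dual basis, multiply out, and sum over the
monomials of `v`. -/
lemma eq_sum_tensorDual {d n : ℕ} (a : Fin d → ℝ) {h : ℝ} (hh : 0 < h)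
    {v : MvPolynomial (Fin d) ℝ} (hv : v ∈ Q d (n + 3)) :
    v = ∑ s : Fin d → Node n, nodesJet a h s v • tensorDual a hh s := by
  rw [MvPolynomial.mem_restrictDegree] at hv
  have key : ∀ m ∈ v.support, MvPolynomial.monomial m (1 : ℝ) =
      ∑ s : Fin d → Node n, nodesJet a h s (MvPolynomial.monomial m 1) • tensorDual a hh s := by
    intro m hm
    rw [← tensor_X_pow]
    have h1 (i : Fin d) := eq_sum_dual (a i) hh (n := n) (p := Polynomial.X ^ m i)
      ((Polynomial.natDegree_X_pow_le _).trans (hv m hm i))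
    conv_lhs => rw [show (fun i => (Polynomial.X ^ m i : Polynomial ℝ)) = _ from funext h1]
    rw [tensor_sum_smul (fun i s => Node.jet (a i) h s (Polynomial.X ^ m i))
      fun i s => dual (a i) hh s]
    simp only [nodesJet_tensor, tensorDual]
  conv_lhs => rw [v.as_sum]
  have hmon (m : Fin d →₀ ℕ) : MvPolynomial.monomial m (v.coeff m) =
      v.coeff m • MvPolynomial.monomial m (1 : ℝ) := by
    rw [MvPolynomial.smul_monomial, smul_eq_mul, mul_one]
  have hsum (s : Fin d → Node n) : nodesJet a h s v =
      ∑ m ∈ v.support, v.coeff m * nodesJet a h s (MvPolynomial.monomial m 1) := by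
    conv_lhs => rw [v.as_sum]
    simp only [hmon, map_sum, map_smul, smul_eq_mul]
  simp only [hsum, Finset.sum_smul]
  rw [Finset.sum_comm]
  refine Finset.sum_congr rfl fun m hm => ?_
  rw [hmon]
  conv_lhs => rw [key m hm]
  rw [Finset.smul_sum]
  simp only [smul_smul]

lemma eq_zero_of_nodesJet_eq_zero {d n : ℕ} (a : Fin d → ℝ) {h : ℝ} (hh : 0 < h)
    {v : MvPolynomial (Fin d) ℝ} (hv : v ∈ Q d (n + 3))
    (hz : ∀ s : Fin d → Node n, nodesJet a h s v = 0) : v = 0 := by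
  rw [eq_sum_tensorDual a hh hv]
  simp [hz]

/-! ### Degrees of freedom as tensor-product Hermite functionals. -/

lemma fin_two_eq_zero_or_one (x : Fin 2) : x = 0 ∨ x = 1 := by
  revert x; decide

/-- The nodes used by the degrees of freedom: those of degree `k - 1` in each variable, when some
derivative is taken at them, and those of degree `k`, when no derivative is taken. -/
def IsDofNode {k : ℕ} : (Fin 3 → Node (k - 4)) ⊕ (Fin 3 → Node (k - 3)) → Prop
  | .inl s => ∃ i, (s i).order = 1
  | .inr s => ∀ i, (s i).order = 0

/-- The nodes of a degree of freedom. -/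
def Dof.node {k : ℕ} : Dof k → (Fin 3 → Node (k - 4)) ⊕ (Fin 3 → Node (k - 3))
  | .vertex s α =>
      if α = 0 then .inr fun i => .inl (s i, 0) else .inl fun i => .inl (s i, α i)
  | .edgeValue i s j => .inr (i.insertNth (.inr j) fun m => .inl (s m, 0))
  | .edgeNormal i s m j =>
      .inl (i.insertNth (.inr j) fun m' => .inl (s m', if m' = m then 1 else 0))
  | .edgeMixed i s j => .inl (i.insertNth (.inr j) fun m => .inl (s m, 1))
  | .faceValue i c j => .inr (i.insertNth (.inl (c, 0)) fun m => .inr (j m))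
  | .faceNormal i c j => .inl (i.insertNth (.inl (c, 1)) fun m => .inr (j m))
  | .interior j => .inr fun i => .inr (j i)

lemma Dof.isDofNode_node {k : ℕ} (m : Dof k) : IsDofNode m.node := by
  cases m with
  | vertex s α =>
    rw [Dof.node]
    split_ifs with hα
    · exact fun i => rfl
    · obtain ⟨i, hi⟩ := Function.ne_iff.1 hα
      exact ⟨i, (fin_two_eq_zero_or_one _).resolve_left hi⟩
  | edgeValue i s j =>
    exact (Fin.forall_iff_succAbove i).2 (by simp [Node.order])
  | edgeNormal i s m j => exact ⟨i.succAbove m, by simp [Node.order]⟩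
  | edgeMixed i s j => exact ⟨i.succAbove 0, by simp [Node.order]⟩
  | faceValue i c j =>
    exact (Fin.forall_iff_succAbove i).2 (by simp [Node.order])
  | faceNormal i c j => exact ⟨i, by simp [Node.order]⟩
  | interior j => exact fun i => rfl

lemma exists_nodes_form {n : ℕ} (s : Fin 3 → Node n) :
    (∃ e : Fin 3 → Fin 2 × Fin 2, s = fun i => .inl (e i)) ∨
    (∃ (i : Fin 3) (j : Fin n) (e : Fin 2 → Fin 2 × Fin 2),
      s = i.insertNth (.inr j) fun m => .inl (e m)) ∨
    (∃ (i : Fin 3) (e : Fin 2 × Fin 2) (j : Fin 2 → Fin n),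
      s = i.insertNth (.inl e) fun m => .inr (j m)) ∨
    ∃ j : Fin 3 → Fin n, s = fun i => .inr (j i) := by
  have hs : s = ![s 0, s 1, s 2] := by
    funext i; fin_cases i <;> rfl
  rw [hs]
  rcases s 0 with x | x <;> rcases s 1 with y | y <;> rcases s 2 with z | z
  · exact .inl ⟨![x, y, z], by funext i; fin_cases i <;> rfl⟩
  · exact .inr (.inl ⟨2, z, ![x, y], by funext i; fin_cases i <;> rfl⟩)
  · exact .inr (.inl ⟨1, y, ![x, z], by funext i; fin_cases i <;> rfl⟩)
  · exact .inr (.inr (.inl ⟨0, x, ![y, z], by funext i; fin_cases i <;> rfl⟩))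
  · exact .inr (.inl ⟨0, x, ![y, z], by funext i; fin_cases i <;> rfl⟩)
  · exact .inr (.inr (.inl ⟨1, y, ![x, z], by funext i; fin_cases i <;> rfl⟩))
  · exact .inr (.inr (.inl ⟨2, z, ![x, y], by funext i; fin_cases i <;> rfl⟩))
  · exact .inr (.inr (.inr ⟨![x, y, z], by funext i; fin_cases i <;> rfl⟩))

/-- The number of mid-point coordinates tells vertices, edges, faces and the interior apart; the
derivative orders at the end-point coordinates then select the degree of freedom. -/
lemma exists_node_eq {k : ℕ} {x : (Fin 3 → Node (k - 4)) ⊕ (Fin 3 → Node (k - 3))}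
    (hx : IsDofNode x) : ∃ m : Dof k, m.node = x := by
  rcases x with s | s <;> simp only [IsDofNode] at hx <;>
    rcases exists_nodes_form s with ⟨e, rfl⟩ | ⟨i, j, e, rfl⟩ | ⟨i, e, j, rfl⟩ | ⟨j, rfl⟩
  · refine ⟨.vertex (fun i => (e i).1) (fun i => (e i).2), ?_⟩
    rw [Dof.node, if_neg]
    rintro h0
    obtain ⟨i, hi⟩ := hx
    have h1 : (e i).2 = 0 := congrFun h0 i
    simp [Node.order, h1] at hi
  · rw [Fin.exists_iff_succAbove i] at hx
    simp only [Fin.insertNth_apply_same, Fin.insertNth_apply_succAbove, Node.order, zero_ne_one,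
      false_or, Fin.exists_fin_two] at hx
    have key (α : Fin 2 → Fin 2) (h0 : α 0 = (e 0).2) (h1 : α 1 = (e 1).2) :
        (fun m => .inl ((e m).1, α m) : Fin 2 → Node (k - 4)) = fun m => .inl (e m) := by
      funext m; fin_cases m <;> simp [h0, h1]
    rcases fin_two_eq_zero_or_one (e 0).2 with h0 | h0 <;>
      rcases fin_two_eq_zero_or_one (e 1).2 with h1 | h1
    · simp [h0, h1] at hx
    · exact ⟨.edgeNormal i (fun m => (e m).1) 1 j, by
        rw [Dof.node, key (fun m => if m = 1 then 1 else 0) (by simp [h0]) (by simp [h1])]⟩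
    · exact ⟨.edgeNormal i (fun m => (e m).1) 0 j, by
        rw [Dof.node, key (fun m => if m = 0 then 1 else 0) (by simp [h0]) (by simp [h1])]⟩
    · exact ⟨.edgeMixed i (fun m => (e m).1) j, by
        rw [Dof.node, key (fun _ => 1) h0.symm h1.symm]⟩
  · rw [Fin.exists_iff_succAbove i] at hx
    simp only [Fin.insertNth_apply_same, Fin.insertNth_apply_succAbove, Node.order, zero_ne_one,
      exists_const, or_false] at hx
    exact ⟨.faceNormal i e.1 j, by rw [Dof.node, ← hx]⟩
  -- No derivative is taken at a mid-point, so an interior triple cannot belong to the `Q_{k-1}`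
  -- family.
  · simp [Node.order] at hx
  · refine ⟨.vertex (fun i => (e i).1) 0, ?_⟩
    rw [Dof.node, if_pos rfl]
    congr 1
    funext i
    rw [← show (e i).2 = 0 from hx i]
  · refine ⟨.edgeValue i (fun m => (e m).1) j, ?_⟩
    rw [Dof.node]
    congr 2
    funext m
    have := hx (i.succAbove m)
    simp only [Fin.insertNth_apply_succAbove, Node.order] at this
    rw [← this]
  · refine ⟨.faceValue i e.1 j, ?_⟩
    have := hx i
    simp only [Fin.insertNth_apply_same, Node.order] at this
    rw [Dof.node, ← this]
  · exact ⟨.interior j, rfl⟩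

/-- The functional attached to the nodes of a degree of freedom. -/
def nodesValue (a : Point) (h : ℝ) {k : ℕ} :
    (Fin 3 → Node (k - 4)) ⊕ (Fin 3 → Node (k - 3)) → MvPolynomial (Fin 3) ℝ →ₗ[ℝ] ℝ
  | .inl s => nodesJet a h s
  | .inr s => nodesJet a h s

lemma tensorJet_mixedDeriv (x : Point) (α : Fin 3 → Fin 2) (v : MvPolynomial (Fin 3) ℝ) :
    tensorJet x 0 (mixedDeriv α v) = tensorJet x α v := by
  have hα : α = ![α 0, α 1, α 2] := by
    funext i; fin_cases i <;> rfl
  rw [hα]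
  rcases fin_two_eq_zero_or_one (α 0) with h0 | h0 <;>
    rcases fin_two_eq_zero_or_one (α 1) with h1 | h1 <;>
    rcases fin_two_eq_zero_or_one (α 2) with h2 | h2 <;>
    simp only [h0, h1, h2, mixedDeriv, Matrix.cons_val, Fin.val_zero, Fin.val_one,
      Function.iterate_zero, Function.iterate_one, id_eq] <;>
    repeat rw [tensorJet_pderiv _ _ _ (by simp)]
  all_goals
    congr 2
    funext i
    fin_cases i <;> rfl

lemma cubePoint_insertNth {n : ℕ} (a : Point) (h : ℝ) (i : Fin 3) (u : Node n)
    (s : Fin 2 → Node n) :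
    cubePoint a h (i.insertNth u.pos fun m => (s m).pos) =
      fun l => a l + h * (i.insertNth (α := fun _ => Node n) u s l).pos := by
  funext l
  revert l
  rw [Fin.forall_iff_succAbove i]
  simp [cubePoint]

lemma order_insertNth {n : ℕ} (i : Fin 3) (u : Node n) (s : Fin 2 → Node n) :
    (fun l => (i.insertNth (α := fun _ => Node n) u s l).order) =
      i.insertNth u.order fun m => (s m).order := by
  funext l
  revert l
  rw [Fin.forall_iff_succAbove i]
  simp

lemma nodesJet_insertNth {n : ℕ} (a : Point) (h : ℝ) (i : Fin 3) (u : Node n)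
    (s : Fin 2 → Node n) (v : MvPolynomial (Fin 3) ℝ) {α : Fin 3 → Fin 2}
    (h1 : α i = u.order) (h2 : ∀ m, α (i.succAbove m) = (s m).order) :
    nodesJet a h (i.insertNth u s) v =
      tensorJet (cubePoint a h (i.insertNth u.pos fun m => (s m).pos)) α v := by
  rw [nodesJet, order_insertNth, cubePoint_insertNth]
  congr 2
  funext l
  revert l
  rw [Fin.forall_iff_succAbove i]
  simp [h1, h2]

lemma Dof.value_eq (a : Point) (h : ℝ) {k : ℕ} (v : MvPolynomial (Fin 3) ℝ) (m : Dof k) :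
    m.value a h v = nodesValue a h m.node v := by
  cases m with
  | vertex s α =>
    rw [Dof.value, eval_eq_tensorJet, tensorJet_mixedDeriv, Dof.node]
    split_ifs with hα
    · subst hα; rfl
    · rfl
  | edgeValue i s j =>
    rw [Dof.value, Dof.node, eval_eq_tensorJet, nodesValue,
      nodesJet_insertNth (α := 0) _ _ _ _ _ _ rfl fun _ => rfl]
    rfl
  | edgeNormal i s m j =>
    rw [Dof.value, Dof.node, eval_eq_tensorJet, tensorJet_pderiv _ _ _ rfl, nodesValue,
      nodesJet_insertNth (α := Function.update 0 (i.succAbove m) 1)]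
    · rfl
    · rw [Function.update_of_ne (Fin.succAbove_ne _ _).symm]
      rfl
    · intro m'
      simp [Node.order, Function.update_apply]
  | edgeMixed i s j =>
    rw [Dof.value, Dof.node, eval_eq_tensorJet, tensorJet_pderiv _ _ _ rfl,
      tensorJet_pderiv _ _ _ (by simp), nodesValue,
      nodesJet_insertNth (α :=
        Function.update (Function.update 0 (i.succAbove 0) 1) (i.succAbove 1) 1)]
    · rfl
    · rw [Function.update_of_ne (Fin.succAbove_ne _ _).symm,
        Function.update_of_ne (Fin.succAbove_ne _ _).symm]
      rfl
    · intro m'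
      fin_cases m' <;> simp [Node.order]
  | faceValue i c j =>
    rw [Dof.value, Dof.node, eval_eq_tensorJet, nodesValue,
      nodesJet_insertNth (α := 0) _ _ _ _ _ _ rfl fun _ => rfl]
    rfl
  | faceNormal i c j =>
    rw [Dof.value, Dof.node, eval_eq_tensorJet, tensorJet_pderiv _ _ _ rfl, nodesValue,
      nodesJet_insertNth (α := Function.update 0 i 1)]
    · rfl
    · rw [Function.update_self]
      rfl
    · intro m'
      rw [Function.update_of_ne (Fin.succAbove_ne _ _)]
      rfl
  | interior j =>
    rw [Dof.value, Dof.node, eval_eq_tensorJet]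
    rfl

/-! ### Counting the degrees of freedom. -/

/-- The degrees of freedom as a sum type. -/
def dofEquiv (k : ℕ) : Dof k ≃
    ((Fin 3 → Fin 2) × (Fin 3 → Fin 2)) ⊕ (Fin 3 × (Fin 2 → Fin 2) × Fin (k - 3)) ⊕
    (Fin 3 × (Fin 2 → Fin 2) × Fin 2 × Fin (k - 4)) ⊕ (Fin 3 × (Fin 2 → Fin 2) × Fin (k - 4)) ⊕
    (Fin 3 × Fin 2 × (Fin 2 → Fin (k - 3))) ⊕ (Fin 3 × Fin 2 × (Fin 2 → Fin (k - 4))) ⊕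
    (Fin 3 → Fin (k - 3)) where
  toFun
    | .vertex s α => .inl (s, α)
    | .edgeValue i s j => .inr (.inl (i, s, j))
    | .edgeNormal i s m j => .inr (.inr (.inl (i, s, m, j)))
    | .edgeMixed i s j => .inr (.inr (.inr (.inl (i, s, j))))
    | .faceValue i c j => .inr (.inr (.inr (.inr (.inl (i, c, j)))))
    | .faceNormal i c j => .inr (.inr (.inr (.inr (.inr (.inl (i, c, j))))))
    | .interior j => .inr (.inr (.inr (.inr (.inr (.inr j)))))
  invFun
    | .inl (s, α) => .vertex s α
    | .inr (.inl (i, s, j)) => .edgeValue i s j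
    | .inr (.inr (.inl (i, s, m, j))) => .edgeNormal i s m j
    | .inr (.inr (.inr (.inl (i, s, j)))) => .edgeMixed i s j
    | .inr (.inr (.inr (.inr (.inl (i, c, j))))) => .faceValue i c j
    | .inr (.inr (.inr (.inr (.inr (.inl (i, c, j)))))) => .faceNormal i c j
    | .inr (.inr (.inr (.inr (.inr (.inr j))))) => .interior j
  left_inv m := by cases m <;> rfl
  right_inv x := by
    rcases x with _ | _ | _ | _ | _ | _ | _ <;> rfl

lemma finite_dof (k : ℕ) : Finite (Dof k) := Finite.of_equiv _ (dofEquiv k).symm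

lemma card_dof (l : ℕ) : Nat.card (Dof (l + 4)) = 64 + 12 * (l + 1) + 36 * l + 6 * (l + 1) ^ 2 +
    6 * l ^ 2 + (l + 1) ^ 3 := by
  rw [Nat.card_congr (dofEquiv (l + 4)), Nat.card_eq_fintype_card]
  simp only [Fintype.card_sum, Fintype.card_prod, Fintype.card_fun, Fintype.card_fin,
    show l + 4 - 3 = l + 1 from rfl, show l + 4 - 4 = l from rfl]
  ring

lemma card_order_eq_zero (n : ℕ) : Nat.card {s : Node n // s.order = 0} = n + 2 := by
  rw [Nat.card_congr (Equiv.subtypeSum), Nat.card_sum, add_comm]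
  congr 1
  · simp [Node.order]
  · simp only [Node.order]
    rw [Nat.card_eq_fintype_card]
    decide

lemma card_forall_order_eq_zero (n : ℕ) :
    Nat.card {s : Fin 3 → Node n // ∀ i, (s i).order = 0} = (n + 2) ^ 3 := by
  rw [Nat.card_congr (Equiv.subtypePiEquivPi (p := fun _ (s : Node n) => s.order = 0)),
    Nat.card_fun, card_order_eq_zero]
  simp

lemma card_exists_order_eq_one (n : ℕ) :
    Nat.card {s : Fin 3 → Node n // ∃ i, (s i).order = 1} + (n + 2) ^ 3 = (n + 4) ^ 3 := by
  classical
  have hcompl (s : Fin 3 → Node n) : (∃ i, (s i).order = 1) ↔ ¬ ∀ i, (s i).order = 0 := by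
    rw [not_forall]
    exact exists_congr fun i =>
      ⟨fun h1 h0 => by simp [h1] at h0, (fin_two_eq_zero_or_one _).resolve_left⟩
  rw [← card_forall_order_eq_zero, Nat.card_congr (Equiv.subtypeEquivRight hcompl), add_comm,
    ← Nat.card_sum, Nat.card_congr (Equiv.sumCompl fun s : Fin 3 → Node n => ∀ i, (s i).order = 0)]
  simp [add_comm]

/-- With `k = l + 4` the count is `k ^ 3 - (k - 2) ^ 3` from the `Q_{k-1}`-family plus `(k - 1) ^ 3`
from the `Q_k`-family. The subtracted term is moved across to stay in the natural numbers. -/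
lemma card_isDofNode (l : ℕ) :
    Nat.card {x // IsDofNode (k := l + 4) x} + (l + 2) ^ 3 = (l + 4) ^ 3 + (l + 3) ^ 3 := by
  rw [Nat.card_congr Equiv.subtypeSum, Nat.card_sum]
  have h1 := card_exists_order_eq_one (l + 4 - 4)
  have h2 := card_forall_order_eq_zero (l + 4 - 3)
  simp only [IsDofNode]
  rw [h2]
  simp only [show l + 4 - 3 = l + 1 from rfl, show l + 4 - 4 = l from rfl] at h1 ⊢
  linarith

/-- Injectivity comes from surjectivity and equal cardinality, with no comparison of cases. It is
what allows arbitrary data to be prescribed on nodes in the existence proof. -/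
lemma node_bijective {k : ℕ} (hk : 4 ≤ k) :
    Function.Bijective fun m : Dof k => (⟨m.node, m.isDofNode_node⟩ : {x // IsDofNode x}) := by
  have := finite_dof k
  rw [Nat.bijective_iff_surjective_and_card]
  refine ⟨fun x => ?_, ?_⟩
  · obtain ⟨m, hm⟩ := exists_node_eq x.2
    exact ⟨m, Subtype.ext hm⟩
  · obtain ⟨l, rfl⟩ := Nat.exists_eq_add_of_le' hk
    have := card_isDofNode l
    rw [card_dof]
    zify at this ⊢
    linear_combination -this

/-! ### Existence. -/

lemma pderiv_tensor_eval_plane (i : Fin 3) (p : Fin 3 → Polynomial ℝ) {c : ℝ} {x : Point}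
    (hx : x i = c) :
    MvPolynomial.eval x (MvPolynomial.pderiv i (tensor p)) = jet c 1 (p i) *
      MvPolynomial.eval (fun m => x (i.succAbove m)) (tensor fun m => p (i.succAbove m)) := by
  rw [pderiv_tensor, eval_tensor, eval_tensor, Fin.prod_univ_succAbove _ i, jet_one, ← hx]
  simp

lemma mem_bellSpace_of_mem_Q_pred {a : Point} {h : ℝ} (hh : 0 < h) {k : ℕ} (hk : 4 ≤ k)
    {v : MvPolynomial (Fin 3) ℝ} (hv : v ∈ Q 3 (k - 1)) : v ∈ bellSpace a h k := by
  obtain ⟨l, rfl⟩ := Nat.exists_eq_add_of_le' hk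
  refine ⟨?_, fun i c => ?_⟩
  · rw [MvPolynomial.mem_restrictDegree] at hv ⊢
    exact fun s hs i => (hv s hs i).trans (Nat.sub_le _ _)
  rw [eq_sum_tensorDual (n := l) a hh hv]
  refine ⟨∑ s : Fin 3 → Node l, nodesJet a h s v •
    jet (a i + h * ((c : ℕ) : ℝ)) 1 (dual (a i) hh (s i)) •
      tensor fun m => dual (a (i.succAbove m)) hh (s (i.succAbove m)), ?_, fun x hx => ?_⟩
  · exact Submodule.sum_mem _ fun s _ => Submodule.smul_mem _ _ (Submodule.smul_mem _ _
      (tensor_mem_Q fun m => natDegree_dual_le _ hh _))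
  · simp only [map_sum, Derivation.map_smul, MvPolynomial.smul_eval, tensorDual,
      pderiv_tensor_eval_plane i _ hx.2]

/-- On the face `(i, c)`, only dual functions with `i`-th node `(c, 1)` have a nonzero normal
derivative, and their coefficients vanish. Zero therefore serves as the polynomial on each face. -/
lemma sum_tensorDual_mem_bellSpace {a : Point} {h : ℝ} (hh : 0 < h) {k : ℕ} (hk : 3 ≤ k)
    {G : (Fin 3 → Node (k - 3)) → ℝ} (hG : ∀ s, (∃ i, (s i).order = 1) → G s = 0) :
    ∑ s, G s • tensorDual a hh s ∈ bellSpace a h k := by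
  refine ⟨Submodule.sum_mem _ fun s _ => Submodule.smul_mem _ _ ?_, fun i c =>
    ⟨0, Submodule.zero_mem _, fun x hx => ?_⟩⟩
  · simpa only [Nat.sub_add_cancel hk] using tensorDual_mem_Q a hh s
  · simp only [map_sum, Derivation.map_smul, MvPolynomial.smul_eval, tensorDual,
      pderiv_tensor_eval_plane i _ hx.2, map_zero]
    refine Finset.sum_eq_zero fun s _ => ?_
    by_cases hs : s i = .inl (c, 1)
    · rw [hG s ⟨i, by rw [hs]; rfl⟩, zero_mul]
    · have := nodeJet_dual (a i) hh (.inl (c, 1)) (s i)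
      rw [if_neg (Ne.symm hs)] at this
      change jet (a i + h * ((c : ℕ) : ℝ)) 1 _ = 0 at this
      rw [this, zero_mul, mul_zero]

/-- The lattice of `s` may differ from that of the sum, because a derivative occurs only at end
points and the two lattices share these. The factor in that one direction already vanishes, whatever
the other nodes are. -/
lemma nodesJet_sum_tensorDual_eq_zero {a : Point} {h : ℝ} (hh : 0 < h) {k n : ℕ}
    {G : (Fin 3 → Node (k - 3)) → ℝ} (hG : ∀ s, (∃ i, (s i).order = 1) → G s = 0)
    {s : Fin 3 → Node n} (hs : ∃ i, (s i).order = 1) :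
    nodesJet a h s (∑ t, G t • tensorDual a hh t) = 0 := by
  obtain ⟨i, hi⟩ := hs
  rw [map_sum]
  refine Finset.sum_eq_zero fun t _ => ?_
  rw [map_smul]
  rcases hsi : s i with e | j
  · rw [hsi] at hi
    by_cases ht : t i = .inl e
    · rw [hG t ⟨i, by rw [ht]; exact hi⟩, zero_smul]
    · rw [tensorDual, nodesJet_tensor, Finset.prod_eq_zero (Finset.mem_univ i), smul_zero]
      rw [hsi]
      exact (nodeJet_dual (a i) hh (.inl e) (t i)).trans (if_neg (Ne.symm ht))
  · rw [hsi] at hi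
    simp [Node.order] at hi

lemma exists_mem_bellSpace_value_eq {a : Point} {h : ℝ} (hh : 0 < h) {k : ℕ} (hk : 4 ≤ k)
    (F : Dof k → ℝ) : ∃ v ∈ bellSpace a h k, ∀ m : Dof k, m.value a h v = F m := by
  classical
  let e := Equiv.ofBijective _ (node_bijective hk)
  -- The value 0 off the image of `Dof.node` is arbitrary: no degree of freedom reads it.
  let G (x : (Fin 3 → Node (k - 4)) ⊕ (Fin 3 → Node (k - 3))) : ℝ :=
    if hx : IsDofNode x then F (e.symm ⟨x, hx⟩) else 0
  have hG (m : Dof k) : G m.node = F m := by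
    simp only [G, dif_pos m.isDofNode_node]
    exact congrArg F (e.symm_apply_apply m)
  let u := ∑ s, G (.inl s) • tensorDual a hh s
  -- At derivative-free nodes, the prescribed value less what `u` already contributes.
  let H (s : Fin 3 → Node (k - 3)) : ℝ :=
    if ∃ i, (s i).order = 1 then 0 else G (.inr s) - nodesJet a h s u
  have hH (s) (hs : ∃ i, (s i).order = 1) : H s = 0 := if_pos hs
  refine ⟨u + ∑ s, H s • tensorDual a hh s, Submodule.add_mem _
    (mem_bellSpace_of_mem_Q_pred hh hk (Submodule.sum_mem _ fun s _ => Submodule.smul_mem _ _ ?_))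
    (sum_tensorDual_mem_bellSpace hh (by omega) hH), fun m => ?_⟩
  · simpa only [show k - 4 + 3 = k - 1 by omega] using tensorDual_mem_Q a hh s
  · have hm := m.isDofNode_node
    rw [Dof.value_eq, ← hG, map_add]
    generalize m.node = x at hm ⊢
    rcases x with s | s
    · simp only [nodesValue]
      rw [nodesJet_sum_tensorDual_eq_zero hh hH hm, nodesJet_sum_tensorDual, add_zero]
    · have hs : ¬ ∃ i, (s i).order = 1 := by
        rintro ⟨i, hi⟩
        rw [hm i] at hi
        exact zero_ne_one hi
      simp only [nodesValue]
      rw [nodesJet_sum_tensorDual]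
      simp only [H, if_neg hs]
      ring

/-! ### Uniqueness. -/

/-- The Bell condition is an equality of functions on a face. Since a face is a product of infinite
sets, it upgrades to an equality of polynomials. -/
lemma restrictPlane_pderiv_mem_Q {a : Point} {h : ℝ} (hh : 0 < h) {k : ℕ}
    {v : MvPolynomial (Fin 3) ℝ} (hv : v ∈ bellSpace a h k) (i : Fin 3) (c : Fin 2) :
    restrictPlane i (a i + h * ((c : ℕ) : ℝ)) (MvPolynomial.pderiv i v) ∈ Q 2 (k - 1) := by
  obtain ⟨q, hq, hqv⟩ := hv.2 i c
  convert hq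
  refine MvPolynomial.funext_set
    (fun m => Set.Icc (a (i.succAbove m)) (a (i.succAbove m) + h))
    (fun m => Set.Icc_infinite (by linarith)) fun y hy => ?_
  rw [eval_restrictPlane, hqv]
  · simp
  · refine ⟨(Fin.forall_iff_succAbove i).2 ⟨?_, fun m => ?_⟩, by simp⟩
    · rw [Fin.insertNth_apply_same]
      rcases fin_two_eq_zero_or_one c with rfl | rfl <;> simp [hh.le]
    · rw [Fin.insertNth_apply_succAbove]
      exact hy m trivial

/-- This identifies the Hermite functionals of the normal derivative on a face with functionals on
the cube whose `i`-th node is `(c, 1)`. -/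
lemma nodesJet_restrictPlane {n : ℕ} (a : Point) (h : ℝ) (i : Fin 3) (c : Fin 2)
    (s : Fin 2 → Node n) (v : MvPolynomial (Fin 3) ℝ) :
    nodesJet (fun m => a (i.succAbove m)) h s
        (restrictPlane i (a i + h * ((c : ℕ) : ℝ)) (MvPolynomial.pderiv i v)) =
      nodesJet a h (i.insertNth (.inl (c, 1)) s) v := by
  rw [nodesJet, tensorJet_restrictPlane, nodesJet_insertNth (α := i.insertNth 1 fun m => (s m).order)
    _ _ _ _ _ _ (by simp [Node.order]) (by simp)]
  congr 2
  funext l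
  revert l
  rw [Fin.forall_iff_succAbove i]
  simp [cubePoint, Node.pos]

lemma eq_zero_of_values_eq_zero {a : Point} {h : ℝ} (hh : 0 < h) {k : ℕ} (hk : 4 ≤ k)
    {v : MvPolynomial (Fin 3) ℝ} (hv : v ∈ bellSpace a h k)
    (hz : ∀ m : Dof k, m.value a h v = 0) : v = 0 := by
  have hnode {x : (Fin 3 → Node (k - 4)) ⊕ (Fin 3 → Node (k - 3))} (hx : IsDofNode x) :
      nodesValue a h x v = 0 := by
    obtain ⟨m, rfl⟩ := exists_node_eq hx
    rw [← Dof.value_eq, hz]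
  have hface (i : Fin 3) (c : Fin 2) :
      restrictPlane i (a i + h * ((c : ℕ) : ℝ)) (MvPolynomial.pderiv i v) = 0 := by
    refine eq_zero_of_nodesJet_eq_zero (n := k - 4) (fun m => a (i.succAbove m)) hh ?_ fun s => ?_
    · rw [show k - 4 + 3 = k - 1 by omega]
      exact restrictPlane_pderiv_mem_Q hh hv i c
    · rw [nodesJet_restrictPlane]
      -- The node in direction `i` has order 1, so every Hermite functional of the face is a degree
      -- of freedom, whatever `s` is.
      exact hnode (x := .inl _) ⟨i, by simp [Node.order]⟩
  refine eq_zero_of_nodesJet_eq_zero (n := k - 3) a hh ?_ fun s => ?_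
  · rw [show k - 3 + 3 = k by omega]
    exact hv.1
  by_cases hs : ∃ i, (s i).order = 1
  · obtain ⟨i, hi⟩ := hs
    rcases hsi : s i with ⟨c, β⟩ | j
    · obtain rfl : β = 1 := by rw [hsi] at hi; exact hi
      -- A derivative in direction `i` sits at an end point, so the functional factors through the
      -- normal derivative on that face, which is zero.
      rw [← Fin.insertNth_self_removeNth i s, hsi, ← nodesJet_restrictPlane, hface, map_zero]
    · rw [hsi] at hi
      simp [Node.order] at hi
  · exact hnode (x := .inr s) fun i =>
      (fin_two_eq_zero_or_one _).resolve_right fun hi => hs ⟨i, hi⟩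

end

end Bell3D

theorem lemma3p1 (k : ℕ) (hk : 4 ≤ k) (a : Bell3D.Point) (h : ℝ) (hh : 0 < h) :
    (Nat.card (Bell3D.Dof k) : ℤ) = (k : ℤ) ^ 3 + 3 * (k : ℤ) ^ 2 - 9 * (k : ℤ) + 7 ∧
      ∀ F : Bell3D.Dof k → ℝ,
        ∃! v : MvPolynomial (Fin 3) ℝ, v ∈ Bell3D.bellSpace a h k ∧
          ∀ m : Bell3D.Dof k, Bell3D.Dof.value a h v m = F m := by
  refine ⟨?_, fun F => ?_⟩
  · obtain ⟨l, rfl⟩ := Nat.exists_eq_add_of_le' hk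
    rw [Bell3D.card_dof]
    push_cast
    ring
  · obtain ⟨v, hv, hvF⟩ := Bell3D.exists_mem_bellSpace_value_eq (a := a) hh hk F
    refine ⟨v, ⟨hv, hvF⟩, fun w hw => ?_⟩
    rw [← sub_eq_zero]
    refine Bell3D.eq_zero_of_values_eq_zero hh hk (Submodule.sub_mem _ hw.1 hv) fun m => ?_
    rw [Bell3D.Dof.value_eq, map_sub, ← Bell3D.Dof.value_eq, ← Bell3D.Dof.value_eq, hw.2, hvF,
      sub_self]
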